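/- Let $N$ be a free nilpotent group of rank $2$ and class $4$ with free basis $x,y$ (that is, $N\cong F_2/\gamma_5F_2$, where $F_2$ is the free group of rank $2$ and $\gamma_5F_2$ the fifth term of its lower central series, and $x,y$ correspond to free generators of $F_2$). Write $(g,h)=g^{-1}h^{-1}gh$, and let longer commutators be left-normed: $(g,h,k,l)=(((g,h),k),l)$. Then: 1. The center $\zeta_1N$ is a free abelian group of rank $3$ with basis $(x,y,x,x)$, $(x,y,y,x)$, $(x,y,y,y)$. 2. Every automorphism $\varphi$ of $N$ induces by restriction an automorphism $\bar\varphi_0$ of $\zeta_1N\cong\mathbb Z^3$ with $\det(\bar\varphi_0-E)=0$, where $E$ is the identity. 3. $N$ has the $R_\infty$ property: for every automorphism $\varphi$ of $N$ the Reidemeister number $R(\varphi)$ is infinite. Here $R(\varphi)$ is the number of classes of the equivalence relation on $N$ under which $g$ and $f$ are equivalent if and only if $\varphi(z)g=fz$ for some $z\in N$. -/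

import Mathlib

open scoped IsMulCommutative

/-- The `φ`-twisted conjugacy relation on a group: `g` and `f` are related when
`φ x * g = f * x` for some `x`. -/
def twistedConjSetoid {G : Type*} [Group G] (φ : G ≃* G) : Setoid G where
  r g f := ∃ x : G, φ x * g = f * x
  iseqv := by
    refine ⟨fun g => ⟨1, by simp⟩, ?_, ?_⟩
    · rintro g f ⟨x, hx⟩
      refine ⟨x⁻¹, ?_⟩
      have hf : f = φ x * g * x⁻¹ := eq_mul_inv_of_mul_eq hx.symm
      rw [hf, map_inv]
      group
    · rintro g f h ⟨x, hx⟩ ⟨y, hy⟩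
      exact ⟨y * x, by rw [map_mul, mul_assoc, hx, ← mul_assoc, hy, mul_assoc]⟩

/-- The Reidemeister number `R(φ)`: the number of `φ`-twisted conjugacy classes, in `ℕ ∪ {∞}`. -/
noncomputable def reidemeisterNumber {G : Type*} [Group G] (φ : G ≃* G) : ℕ∞ :=
  ENat.card (Quotient (twistedConjSetoid φ))

/-- The `R_∞` property: every automorphism has infinite Reidemeister number. -/
def HasRInfinity (G : Type*) [Group G] : Prop :=
  ∀ φ : G ≃* G, reidemeisterNumber φ = ⊤

/-- The free nilpotent group of rank `r` and class `c`: the quotient of the free group of rank `r`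
by the `(c + 1)`-st term of its lower central series. Mathlib numbers the terms of the series from
`0`, the whole group being term `0`, so this is its term `c`. -/
abbrev FreeNilpotentGroup (r c : ℕ) : Type :=
  FreeGroup (Fin r) ⧸ (⊤ : Subgroup (FreeGroup (Fin r))).lowerCentralSeries c

/-- The canonical free generators of the free nilpotent group. -/
def FreeNilpotentGroup.gen {r c : ℕ} (i : Fin r) : FreeNilpotentGroup r c :=
  QuotientGroup.mk (FreeGroup.of i)

/-- The commutator `(g, h) = g⁻¹ h⁻¹ g h`. -/
def groupComm {G : Type*} [Group G] (g h : G) : G :=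
  g⁻¹ * h⁻¹ * g * h

/-- The left-normed commutator `(g, h, k, l) = (((g, h), k), l)` of weight four. -/
def groupComm₄ {G : Type*} [Group G] (g h k l : G) : G :=
  groupComm (groupComm (groupComm g h) k) l

/-- The automorphism of the centre, written additively as a `ℤ`-module, that an automorphism of
the group induces by restriction. -/
def centerAut {G : Type*} [Group G] (φ : G ≃* G) :
    Additive (Subgroup.center G) ≃ₗ[ℤ] Additive (Subgroup.center G) :=
  (MulEquiv.toAdditive (Subgroup.centerCongr φ)).toIntLinearEquiv

theorem centerAut_apply {G : Type*} [Group G] (φ : G ≃* G)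
    (c : Additive (Subgroup.center G)) :
    ((centerAut φ c).toMul : G) = φ (c.toMul : G) := rfl

/-!
Let `N` be free nilpotent of rank two and class four. By the three subgroups lemma the second and
third terms of the lower central series of `N` commute, and since the second one is cyclic modulo
the third, the commutator subgroup is abelian (`commute_of_mem_commutator`). Hence `x` and `y` act
on it by commuting conjugations, and it becomes a module over `ℤ[X, Y] / (X, Y)³` generated by
`(x, y)`, on which `X` and `Y` act as `c ↦ (c, x)` and `c ↦ (c, y)`. That this module is free of
rank one is seen from an explicit model: `PolyModel` is the set of triples `(a, b, r)`, standing for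
`x ^ a * y ^ b * ρ` with `ρ` the multiple of `(x, y)` by `r`, with the product that the module
structure dictates. It has class four, and normal forms show that it is isomorphic to `N`
(`exists_mulEquiv_polyModel`). The centre consists of the multiples of `(x, y)` by quadratic forms,
and `X²`, `XY`, `Y²` correspond to `(x, y, x, x)`, `(x, y, y, x)`, `(x, y, y, y)`.

Let an automorphism act on `N` modulo commutators by a matrix `A`, with eigenvalues `λ` and `μ` and
determinant `δ = λμ = ±1`. Commutator identities show that it acts on the successive quotients of
the lower central series by `A`, `δ`, `δ A` and `δ Sym² A`. The last one has eigenvalue `δλμ = 1`,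
which is the statement on the determinant (`PolyModel.det_centerMatrix_sub_one`).

For the Reidemeister number (`PolyModel.exists_separated`), consider the first quotient on which `1`
is an eigenvalue. Since the automorphism has no nontrivial fixed points on the earlier ones,
elements of that term of the series can only be twisted conjugate to each other by elements of the
same term, so that infinitely many classes are separated by an invariant functional on the quotient.
That quotient is the first one if `1` is an eigenvalue of `A`, otherwise the second one if `δ = 1`,
and otherwise the fourth one: if `δ = -1` and `1` is not an eigenvalue of `A`, then the trace of `A`
is not zero, and `-1` is not an eigenvalue either.
-/

open scoped commutatorElement

/-! ### Truncated polynomials -/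

/-- The commutative ring `ℤ[X, Y] / (X, Y)³`, an element being given by its coefficients at
`1, X, Y, X², XY, Y²`. -/
@[ext]
structure TruncPoly where
  c : ℤ
  cx : ℤ
  cy : ℤ
  cxx : ℤ
  cxy : ℤ
  cyy : ℤ

namespace TruncPoly

instance : Zero TruncPoly := ⟨⟨0, 0, 0, 0, 0, 0⟩⟩
instance : One TruncPoly := ⟨⟨1, 0, 0, 0, 0, 0⟩⟩
instance : Add TruncPoly :=
  ⟨fun p q => ⟨p.c + q.c, p.cx + q.cx, p.cy + q.cy, p.cxx + q.cxx, p.cxy + q.cxy, p.cyy + q.cyy⟩⟩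
instance : Neg TruncPoly := ⟨fun p => ⟨-p.c, -p.cx, -p.cy, -p.cxx, -p.cxy, -p.cyy⟩⟩
instance : Mul TruncPoly :=
  ⟨fun p q => ⟨p.c * q.c, p.c * q.cx + p.cx * q.c, p.c * q.cy + p.cy * q.c,
    p.c * q.cxx + p.cx * q.cx + p.cxx * q.c,
    p.c * q.cxy + p.cx * q.cy + p.cy * q.cx + p.cxy * q.c,
    p.c * q.cyy + p.cy * q.cy + p.cyy * q.c⟩⟩

theorem zero_def : (0 : TruncPoly) = ⟨0, 0, 0, 0, 0, 0⟩ := rfl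
theorem one_def : (1 : TruncPoly) = ⟨1, 0, 0, 0, 0, 0⟩ := rfl
theorem add_def (p q : TruncPoly) : p + q =
    ⟨p.c + q.c, p.cx + q.cx, p.cy + q.cy, p.cxx + q.cxx, p.cxy + q.cxy, p.cyy + q.cyy⟩ := rfl
theorem neg_def (p : TruncPoly) : -p = ⟨-p.c, -p.cx, -p.cy, -p.cxx, -p.cxy, -p.cyy⟩ := rfl
theorem mul_def (p q : TruncPoly) : p * q =
    ⟨p.c * q.c, p.c * q.cx + p.cx * q.c, p.c * q.cy + p.cy * q.c,
      p.c * q.cxx + p.cx * q.cx + p.cxx * q.c,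
      p.c * q.cxy + p.cx * q.cy + p.cy * q.cx + p.cxy * q.c,
      p.c * q.cyy + p.cy * q.cy + p.cyy * q.c⟩ := rfl

instance : CommRing TruncPoly where
  add_assoc p q r := by simp only [add_def, add_assoc]
  zero_add p := by simp [zero_def, add_def]
  add_zero p := by simp [zero_def, add_def]
  add_comm p q := by simp only [add_def, add_comm]
  neg_add_cancel p := by simp [zero_def, add_def, neg_def]
  mul_assoc p q r := by simp only [mul_def, mk.injEq]; refine ⟨?_, ?_, ?_, ?_, ?_, ?_⟩ <;> ring
  one_mul p := by simp [one_def, mul_def]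
  mul_one p := by simp [one_def, mul_def]
  mul_comm p q := by simp only [mul_def, mk.injEq]; refine ⟨?_, ?_, ?_, ?_, ?_, ?_⟩ <;> ring
  left_distrib p q r := by
    simp only [mul_def, add_def, mk.injEq]; refine ⟨?_, ?_, ?_, ?_, ?_, ?_⟩ <;> ring
  right_distrib p q r := by
    simp only [mul_def, add_def, mk.injEq]; refine ⟨?_, ?_, ?_, ?_, ?_, ?_⟩ <;> ring
  zero_mul p := by simp [zero_def, mul_def]
  mul_zero p := by simp [zero_def, mul_def]
  nsmul := nsmulRec
  zsmul := zsmulRec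

theorem sub_def (p q : TruncPoly) : p - q =
    ⟨p.c - q.c, p.cx - q.cx, p.cy - q.cy, p.cxx - q.cxx, p.cxy - q.cxy, p.cyy - q.cyy⟩ := by
  rw [sub_eq_add_neg]; rfl

/-- The class of `X`. -/
def X : TruncPoly := ⟨0, 1, 0, 0, 0, 0⟩

/-- The class of `Y`. -/
def Y : TruncPoly := ⟨0, 0, 1, 0, 0, 0⟩

theorem zsmul_def (n : ℤ) (p : TruncPoly) :
    n • p = ⟨n * p.c, n * p.cx, n * p.cy, n * p.cxx, n * p.cxy, n * p.cyy⟩ := by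
  let f : ℤ →+ TruncPoly :=
    { toFun := fun n => ⟨n * p.c, n * p.cx, n * p.cy, n * p.cxx, n * p.cxy, n * p.cyy⟩
      map_zero' := by simp [zero_def]
      map_add' := fun m n => by simp [add_def, add_mul] }
  simpa [f] using (map_zsmul f n 1).symm

/-- A truncated polynomial is the integral combination of monomials with its coefficients. -/
theorem eq_sum_monomials (p : TruncPoly) :
    p = p.c • 1 + p.cx • X + p.cy • Y + p.cxx • (X * X) + p.cxy • (X * Y) + p.cyy • (Y * Y) := by
  simp [-zsmul_eq_mul, zsmul_def, X, Y, one_def, add_def, mul_def]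

end TruncPoly

/-- The binomial coefficient `n (n - 1) / 2`, for an integer `n` of any sign. -/
def intChooseTwo (n : ℤ) : ℤ := n * (n - 1) / 2

/-- The binomial coefficient `n (n - 1) (n - 2) / 6`, for an integer `n` of any sign. -/
def intChooseThree (n : ℤ) : ℤ := n * (n - 1) * (n - 2) / 6

theorem two_mul_intChooseTwo (n : ℤ) : 2 * intChooseTwo n = n * (n - 1) :=
  Int.mul_ediv_cancel' (Int.even_mul_pred_self n).two_dvd

theorem six_mul_intChooseThree (n : ℤ) : 6 * intChooseThree n = n * (n - 1) * (n - 2) := by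
  refine Int.mul_ediv_cancel' ?_
  refine Int.dvd_of_emod_eq_zero ?_
  have h : n % 6 = 0 ∨ n % 6 = 1 ∨ n % 6 = 2 ∨ n % 6 = 3 ∨ n % 6 = 4 ∨ n % 6 = 5 := by omega
  rcases h with h | h | h | h | h | h <;> simp [Int.mul_emod, Int.sub_emod, h]

theorem intChooseTwo_add (m n : ℤ) :
    intChooseTwo (m + n) = intChooseTwo m + m * n + intChooseTwo n := by
  have h1 := two_mul_intChooseTwo (m + n)
  have h2 := two_mul_intChooseTwo m
  have h3 := two_mul_intChooseTwo n
  have : 2 * intChooseTwo (m + n) = 2 * (intChooseTwo m + m * n + intChooseTwo n) := by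
    linear_combination h1 - h2 - h3
  linarith

theorem intChooseThree_add (m n : ℤ) :
    intChooseThree (m + n) =
      intChooseThree m + intChooseTwo m * n + m * intChooseTwo n + intChooseThree n := by
  have h1 := six_mul_intChooseThree (m + n)
  have h2 := six_mul_intChooseThree m
  have h3 := six_mul_intChooseThree n
  have : 6 * intChooseThree (m + n) = 6 * (intChooseThree m + intChooseTwo m * n +
      m * intChooseTwo n + intChooseThree n) := by
    linear_combination h1 - h2 - h3 - 3 * n * two_mul_intChooseTwo m -
      3 * m * two_mul_intChooseTwo n
  linarith

namespace TruncPoly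

/-- The power `(1 + X) ^ n`, for an integer `n`. -/
def powX (n : ℤ) : TruncPoly := ⟨1, n, 0, intChooseTwo n, 0, 0⟩

/-- The power `(1 + Y) ^ n`, for an integer `n`. -/
def powY (n : ℤ) : TruncPoly := ⟨1, 0, n, 0, 0, intChooseTwo n⟩

/-- The quotient `((1 + X) ^ n - 1) / X`. Division by `X` makes sense for polynomials and loses one
degree, so that a binomial coefficient of order three appears. -/
def quotX (n : ℤ) : TruncPoly := ⟨n, intChooseTwo n, 0, intChooseThree n, 0, 0⟩

/-- The quotient `((1 + Y) ^ n - 1) / Y`. -/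
def quotY (n : ℤ) : TruncPoly := ⟨n, 0, intChooseTwo n, 0, 0, intChooseThree n⟩

@[simp] theorem powX_zero : powX 0 = 1 := rfl
@[simp] theorem powY_zero : powY 0 = 1 := rfl
@[simp] theorem quotX_zero : quotX 0 = 0 := rfl
@[simp] theorem quotY_zero : quotY 0 = 0 := rfl
theorem powX_one : powX 1 = 1 + X := rfl
theorem powY_one : powY 1 = 1 + Y := rfl
@[simp] theorem quotX_one : quotX 1 = 1 := rfl
@[simp] theorem quotY_one : quotY 1 = 1 := rfl

theorem powX_add (m n : ℤ) : powX (m + n) = powX m * powX n := by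
  simp only [powX, mul_def, intChooseTwo_add, mk.injEq]
  refine ⟨?_, ?_, ?_, ?_, ?_, ?_⟩ <;> ring

theorem powY_add (m n : ℤ) : powY (m + n) = powY m * powY n := by
  simp only [powY, mul_def, intChooseTwo_add, mk.injEq]
  refine ⟨?_, ?_, ?_, ?_, ?_, ?_⟩ <;> ring

theorem quotX_add (m n : ℤ) : quotX (m + n) = quotX m * powX n + quotX n := by
  simp only [powX, quotX, mul_def, add_def, intChooseTwo_add, intChooseThree_add, mk.injEq]
  refine ⟨?_, ?_, ?_, ?_, ?_, ?_⟩ <;> ring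

theorem quotY_add (m n : ℤ) : quotY (m + n) = quotY m * powY n + quotY n := by
  simp only [powY, quotY, mul_def, add_def, intChooseTwo_add, intChooseThree_add, mk.injEq]
  refine ⟨?_, ?_, ?_, ?_, ?_, ?_⟩ <;> ring

theorem powX_neg_mul (n : ℤ) : powX (-n) * powX n = 1 := by rw [← powX_add]; simp

theorem powY_neg_mul (n : ℤ) : powY (-n) * powY n = 1 := by rw [← powY_add]; simp

end TruncPoly

/-! ### The model group -/

/-- A concrete model of the free nilpotent group of rank two and class four. The triple `(a, b, r)`
stands for the element `x ^ a * y ^ b * ρ`, where `ρ` is the element of the commutator subgroup that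
`r` gives when that subgroup is identified with `ℤ[X, Y] / (X, Y)³`, the commutator `(x, y)` with
`1`, and conjugation by `x` and by `y` with multiplication by `1 + X` and by `1 + Y`. -/
@[ext]
structure PolyModel where
  a : ℤ
  b : ℤ
  r : TruncPoly

namespace PolyModel

open TruncPoly

instance : One PolyModel := ⟨⟨0, 0, 0⟩⟩

-- The middle term moves `y ^ g.b` past `x ^ h.a`.
instance : Mul PolyModel :=
  ⟨fun g h => ⟨g.a + h.a, g.b + h.b,
    powX h.a * powY h.b * g.r - powY h.b * quotY g.b * quotX h.a + h.r⟩⟩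

instance : Inv PolyModel :=
  ⟨fun g => ⟨-g.a, -g.b,
    -(powX (-g.a) * powY (-g.b) * (g.r - powY g.b * quotY (-g.b) * quotX g.a))⟩⟩

theorem one_def : (1 : PolyModel) = ⟨0, 0, 0⟩ := rfl

theorem mul_def (g h : PolyModel) : g * h = ⟨g.a + h.a, g.b + h.b,
    powX h.a * powY h.b * g.r - powY h.b * quotY g.b * quotX h.a + h.r⟩ := rfl

theorem inv_def (g : PolyModel) : g⁻¹ = ⟨-g.a, -g.b,
    -(powX (-g.a) * powY (-g.b) * (g.r - powY g.b * quotY (-g.b) * quotX g.a))⟩ := rfl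

instance : Group PolyModel := Group.ofLeftAxioms
  (fun g h k => by
    simp only [mul_def, mk.injEq, powX_add, powY_add, quotX_add, quotY_add]
    exact ⟨by ring, by ring, by ring⟩)
  (fun g => by simp [mul_def, one_def])
  (fun g => by
    simp only [mul_def, inv_def, one_def, mk.injEq]
    refine ⟨by ring, by ring, ?_⟩
    linear_combination (-(powY g.b * powY (-g.b)) * (g.r - powY g.b * quotY (-g.b) * quotX g.a)) *
      powX_neg_mul g.a - (g.r - powY g.b * quotY (-g.b) * quotX g.a) * powY_neg_mul g.b)

/-- The first canonical generator. -/
def x : PolyModel := ⟨1, 0, 0⟩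

/-- The second canonical generator. -/
def y : PolyModel := ⟨0, 1, 0⟩

/-- The inclusion of the commutator subgroup. -/
def ι : Multiplicative TruncPoly →* PolyModel where
  toFun r := ⟨0, 0, r.toAdd⟩
  map_one' := rfl
  map_mul' r s := by simp [mul_def]

/-- The exponent of `x`. -/
def expX : PolyModel →* Multiplicative ℤ where
  toFun g := .ofAdd g.a
  map_one' := rfl
  map_mul' _ _ := rfl

/-- The exponent of `y`. -/
def expY : PolyModel →* Multiplicative ℤ where
  toFun g := .ofAdd g.b
  map_one' := rfl
  map_mul' _ _ := rfl

theorem mk_zero_zero_mul (r s : TruncPoly) :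
    (⟨0, 0, r⟩ * ⟨0, 0, s⟩ : PolyModel) = ⟨0, 0, r + s⟩ := by
  simp [mul_def]

theorem mk_zero_zero_zpow (r : TruncPoly) (n : ℤ) : (⟨0, 0, r⟩ ^ n : PolyModel) = ⟨0, 0, n • r⟩ :=
  (map_zpow ι (.ofAdd r) n).symm

theorem x_zpow (n : ℤ) : x ^ n = ⟨n, 0, 0⟩ := by
  let f : Multiplicative ℤ →* PolyModel :=
    { toFun := fun n => ⟨n.toAdd, 0, 0⟩
      map_one' := rfl
      map_mul' := fun m n => by simp [mul_def] }
  simpa [f, x, ← ofAdd_zsmul] using (map_zpow f (.ofAdd 1) n).symm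

theorem y_zpow (n : ℤ) : y ^ n = ⟨0, n, 0⟩ := by
  let f : Multiplicative ℤ →* PolyModel :=
    { toFun := fun n => ⟨0, n.toAdd, 0⟩
      map_one' := rfl
      map_mul' := fun m n => by simp [mul_def] }
  simpa [f, y, ← ofAdd_zsmul] using (map_zpow f (.ofAdd 1) n).symm

theorem eq_zpow_mul_zpow_mul (g : PolyModel) : g = x ^ g.a * y ^ g.b * ⟨0, 0, g.r⟩ := by
  simp [x_zpow, y_zpow, mul_def]

end PolyModel

theorem groupComm_eq_of_mul_eq {G : Type*} [Group G] {g h k : G} (H : g * h = h * g * k) :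
    groupComm g h = k := by
  rw [groupComm, mul_assoc, H]; group

theorem map_groupComm {G H : Type*} [Group G] [Group H] (f : G →* H) (g h : G) :
    f (groupComm g h) = groupComm (f g) (f h) := by
  simp [groupComm]

namespace PolyModel

open TruncPoly

theorem groupComm_mk (a b c d : ℤ) (r s : TruncPoly) :
    groupComm (⟨a, b, r⟩ : PolyModel) ⟨c, d, s⟩ =
      ⟨0, 0, (powX c * powY d - 1) * r - (powX a * powY b - 1) * s +
        powY b * quotY d * quotX a - powY d * quotY b * quotX c⟩ := by
  refine groupComm_eq_of_mul_eq ?_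
  simp only [mul_def, mk.injEq, powX_zero, powY_zero, quotX_zero]
  exact ⟨by ring, by ring, by ring⟩

theorem groupComm_mk_zero_zero (r : TruncPoly) (g : PolyModel) :
    groupComm (⟨0, 0, r⟩ : PolyModel) g = ⟨0, 0, (powX g.a * powY g.b - 1) * r⟩ := by
  obtain ⟨a, b, s⟩ := g
  simp [groupComm_mk]

theorem groupComm_x_y : groupComm x y = ⟨0, 0, 1⟩ := by
  simp [x, y, groupComm_mk]

theorem groupComm_mk_zero_zero_x (r : TruncPoly) :
    groupComm (⟨0, 0, r⟩ : PolyModel) x = ⟨0, 0, X * r⟩ := by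
  simp [groupComm_mk_zero_zero, x, powX_one]

theorem groupComm_mk_zero_zero_y (r : TruncPoly) :
    groupComm (⟨0, 0, r⟩ : PolyModel) y = ⟨0, 0, Y * r⟩ := by
  simp [groupComm_mk_zero_zero, y, powY_one]

/-- An element of the centre commutes with both generators, which forces it to be given by a
homogeneous polynomial of degree two. -/
theorem mem_center_iff {g : PolyModel} :
    g ∈ Subgroup.center PolyModel ↔
      g.a = 0 ∧ g.b = 0 ∧ g.r.c = 0 ∧ g.r.cx = 0 ∧ g.r.cy = 0 := by
  obtain ⟨a, b, r⟩ := g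
  rw [Subgroup.mem_center_iff]
  constructor
  · intro h
    have hx := h x
    have hy := h y
    simp [mul_def, x, y, TruncPoly.mul_def, TruncPoly.add_def, TruncPoly.sub_def,
      TruncPoly.zero_def, TruncPoly.ext_iff, powX, powY, quotX, quotY] at hx hy
    simp
    grind
  · rintro ⟨rfl, rfl, h0, h1, h2⟩ ⟨c, d, s⟩
    simp only at h0 h1 h2
    simp [mul_def, TruncPoly.mul_def, TruncPoly.add_def, powX, powY, h0, h1, h2,
      add_comm, show intChooseTwo 0 = 0 from rfl]

theorem commutatorElement_mk_zero_zero (r : TruncPoly) (g : PolyModel) :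
    ⁅(⟨0, 0, r⟩ : PolyModel), g⁆ = ⟨0, 0, (powX (-g.a) * powY (-g.b) - 1) * -r⟩ := by
  have h : ⁅(⟨0, 0, r⟩ : PolyModel), g⁆ = groupComm (⟨0, 0, -r⟩ : PolyModel) g⁻¹ := by
    have hr : (⟨0, 0, -r⟩ : PolyModel) = (⟨0, 0, r⟩ : PolyModel)⁻¹ := (map_inv ι (.ofAdd r))
    rw [hr, commutatorElement_def, groupComm, inv_inv, inv_inv]
  rw [h, groupComm_mk_zero_zero, inv_def]

/-- The commutator subgroup consists of the triples `(0, 0, r)`, and each further commutator raises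
the order of `r` by one. -/
theorem lowerCentralSeries_four :
    (⊤ : Subgroup PolyModel).lowerCentralSeries 4 = ⊥ := by
  rw [Subgroup.lowerCentralSeries_eq_bot_iff_upperCentralSeries_eq_top, Subgroup.eq_top_iff']
  have h1 (r : TruncPoly) (h : r.c = 0 ∧ r.cx = 0 ∧ r.cy = 0) :
      (⟨0, 0, r⟩ : PolyModel) ∈ Subgroup.upperCentralSeries PolyModel 1 := by
    rw [Subgroup.upperCentralSeries_one, mem_center_iff]
    simpa using h
  have h2 (r : TruncPoly) (h : r.c = 0) :
      (⟨0, 0, r⟩ : PolyModel) ∈ Subgroup.upperCentralSeries PolyModel 2 := by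
    refine Subgroup.mem_upperCentralSeries_succ_iff.mpr fun g => ?_
    rw [commutatorElement_mk_zero_zero]
    apply h1
    simp [TruncPoly.mul_def, TruncPoly.sub_def, TruncPoly.neg_def, TruncPoly.one_def, powX, powY, h]
  have h3 (r : TruncPoly) :
      (⟨0, 0, r⟩ : PolyModel) ∈ Subgroup.upperCentralSeries PolyModel 3 := by
    refine Subgroup.mem_upperCentralSeries_succ_iff.mpr fun g => ?_
    rw [commutatorElement_mk_zero_zero]
    apply h2
    simp [TruncPoly.mul_def, TruncPoly.sub_def, TruncPoly.neg_def, TruncPoly.one_def, powX, powY]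
  intro g
  refine Subgroup.mem_upperCentralSeries_succ_iff.mpr fun h => ?_
  have ha : (⁅g, h⁆).a = 0 := by simp [commutatorElement_def, mul_def, inv_def]
  have hb : (⁅g, h⁆).b = 0 := by simp [commutatorElement_def, mul_def, inv_def]
  rw [show ⁅g, h⁆ = ⟨0, 0, (⁅g, h⁆).r⟩ from PolyModel.ext ha hb rfl]
  exact h3 _

end PolyModel

/-! ### Normal forms in groups of class four on two generators -/

/-- Modulo a normal subgroup that contains the commutator of two generators, the group is
commutative. -/
theorem commutator_le_of_closure_pair_eq_top {G : Type*} [Group G] {x y : G}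
    (hgen : Subgroup.closure {x, y} = (⊤ : Subgroup G)) (K : Subgroup G) [K.Normal]
    (hK : ⁅x, y⁆ ∈ K) : commutator G ≤ K := by
  have hxy : Commute (x : G ⧸ K) (y : G ⧸ K) := by
    rw [← commutatorElement_eq_one_iff_commute]
    exact (QuotientGroup.eq_one_iff _).mpr hK
  have htop : Subgroup.closure {(x : G ⧸ K), (y : G ⧸ K)} = ⊤ := by
    have := congrArg (Subgroup.map (QuotientGroup.mk' K)) hgen
    rw [MonoidHom.map_closure,
      Subgroup.map_top_of_surjective _ (QuotientGroup.mk'_surjective K), Set.image_pair] at this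
    exact this
  have hcomm : ∀ s ∈ ({(x : G ⧸ K), (y : G ⧸ K)} : Set (G ⧸ K)),
      ∀ t ∈ ({(x : G ⧸ K), (y : G ⧸ K)} : Set (G ⧸ K)), s * t = t * s := by
    rintro s (rfl | rfl) t (rfl | rfl)
    · rfl
    · exact hxy
    · exact hxy.symm
    · rfl
  have := Subgroup.isMulCommutative_closure hcomm
  rw [htop] at this
  rw [commutator_def, Subgroup.commutator_le]
  intro g _ h _
  have hgh : (g : G ⧸ K) * h = h * g :=
    setLike_mul_comm (s := (⊤ : Subgroup (G ⧸ K))) (Subgroup.mem_top _) (Subgroup.mem_top _)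
  exact (QuotientGroup.eq_one_iff _).mp (commutatorElement_eq_one_iff_mul_comm.mpr hgh)

open Subgroup in
/-- In a group of class at most four on two generators, the commutator subgroup is abelian: it is
generated by one commutator modulo the third term of the lower central series, with which it
commutes by the three subgroups lemma. -/
theorem commute_of_mem_commutator {G : Type*} [Group G] {x y : G}
    (hgen : closure {x, y} = (⊤ : Subgroup G)) (hG : (⊤ : Subgroup G).lowerCentralSeries 4 = ⊥)
    {p q : G} (hp : p ∈ commutator G) (hq : q ∈ commutator G) : Commute p q := by
  set γ := (⊤ : Subgroup G).lowerCentralSeries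
  -- The second and the third term of the series commute.
  have h12 : ⁅γ 1, γ 2⁆ = ⊥ := by
    have h4 : ⁅⁅(⊤ : Subgroup G), γ 2⁆, (⊤ : Subgroup G)⁆ = ⊥ := by
      rw [commutator_comm (⊤ : Subgroup G) (γ 2)]; exact hG
    have h4' : ⁅⁅γ 2, (⊤ : Subgroup G)⁆, (⊤ : Subgroup G)⁆ = ⊥ := hG
    exact commutator_commutator_eq_bot_of_rotate h4 h4'
  have hc (s t : G) (hs : s ∈ γ 1) (ht : t ∈ γ 2) : Commute s t := by
    rw [← commutatorElement_eq_one_iff_commute, ← mem_bot, ← h12]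
    exact commutator_mem_commutator hs ht
  have hle : γ 2 ≤ γ 1 := Subgroup.lowerCentralSeries_antitone _ (by norm_num)
  have hw : ⁅x, y⁆ ∈ γ 1 := commutator_mem_commutator (mem_top _) (mem_top _)
  have key (p : G) (hp : p ∈ γ 1) : ∃ n : ℤ, ∃ t ∈ γ 2, p = ⁅x, y⁆ ^ n * t := by
    have hK : (zpowers ⁅x, y⁆ ⊔ γ 2) ≤ γ 1 := sup_le (by simpa using hw) hle
    have hKn : (zpowers ⁅x, y⁆ ⊔ γ 2).Normal := by
      refine ⟨fun k hk g => ?_⟩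
      have : ⁅g, k⁆ ∈ γ 2 := by
        rw [← commutatorElement_inv, inv_mem_iff]
        exact commutator_mem_commutator (hK hk) (mem_top _)
      have h := mul_mem (mem_sup_right (S := zpowers ⁅x, y⁆) this) hk
      simpa [commutatorElement_def] using h
    have hle' := commutator_le_of_closure_pair_eq_top hgen (zpowers ⁅x, y⁆ ⊔ γ 2)
      (mem_sup_left (mem_zpowers _))
    obtain ⟨s, hs, t, ht, rfl⟩ := mem_sup_of_normal_right.mp (hle' hp)
    obtain ⟨n, rfl⟩ := mem_zpowers_iff.mp hs
    exact ⟨n, t, ht, rfl⟩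
  obtain ⟨m, s, hs, rfl⟩ := key p hp
  obtain ⟨n, t, ht, rfl⟩ := key q hq
  refine Commute.mul_left ?_ (Commute.mul_right ?_ ?_)
  · exact Commute.mul_right ((Commute.refl _).zpow_zpow m n) (hc _ _ (zpow_mem hw m) ht)
  · exact (hc _ _ (zpow_mem hw n) hs).symm
  · exact hc _ _ (hle hs) ht

theorem groupComm_eq_commutatorElement {G : Type*} [Group G] (g h : G) :
    groupComm g h = ⁅g⁻¹, h⁻¹⁆ := by
  simp [groupComm, commutatorElement_def]

theorem groupComm_mem_lowerCentralSeries {G : Type*} [Group G] {n : ℕ} {g : G}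
    (hg : g ∈ (⊤ : Subgroup G).lowerCentralSeries n) (h : G) :
    groupComm g h ∈ (⊤ : Subgroup G).lowerCentralSeries (n + 1) := by
  rw [groupComm_eq_commutatorElement]
  exact Subgroup.commutator_mem_commutator (inv_mem hg) (Subgroup.mem_top _)

/-- If the commutator subgroup is abelian, conjugations by any two elements commute on it. -/
theorem groupComm_groupComm_comm {G : Type*} [Group G]
    (hab : ∀ p ∈ commutator G, ∀ q ∈ commutator G, Commute p q) {w : G} (hw : w ∈ commutator G)
    (x y : G) : groupComm (groupComm w x) y = groupComm (groupComm w y) x := by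
  have hn (g : G) : g⁻¹ * w * g ∈ commutator G := by
    simpa using (inferInstance : (commutator G).Normal).conj_mem w hw g⁻¹
  have hc : groupComm y x ∈ commutator G :=
    groupComm_mem_lowerCentralSeries (n := 0) (Subgroup.mem_top y) x
  have hconj : (x * y)⁻¹ * w * (x * y) = (y * x)⁻¹ * w * (y * x) := by
    have h := hab _ (hn (x * y)) _ hc
    have e : y * x = x * y * groupComm y x := by simp [groupComm, mul_assoc]
    calc (x * y)⁻¹ * w * (x * y)
        = (groupComm y x)⁻¹ * (groupComm y x * ((x * y)⁻¹ * w * (x * y))) :=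
          (inv_mul_cancel_left _ _).symm
      _ = (groupComm y x)⁻¹ * ((x * y)⁻¹ * w * (x * y) * groupComm y x) := by rw [h.eq]
      _ = (x * y * groupComm y x)⁻¹ * w * (x * y * groupComm y x) := by
          simp only [mul_inv_rev, mul_assoc]
      _ = (y * x)⁻¹ * w * (y * x) := by rw [← e]
  have hx := hn x
  have hy := hn y
  have e1 : groupComm (groupComm w x) y = (x⁻¹ * w * x)⁻¹ * w * ((y⁻¹ * w * y)⁻¹ *
      ((x * y)⁻¹ * w * (x * y))) := by simp only [groupComm]; group
  have e2 : groupComm (groupComm w y) x = (y⁻¹ * w * y)⁻¹ * w * ((x⁻¹ * w * x)⁻¹ *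
      ((y * x)⁻¹ * w * (y * x))) := by simp only [groupComm]; group
  rw [e1, e2, ← hconj]
  generalize (x * y)⁻¹ * w * (x * y) = k
  have h1 : Commute (x⁻¹ * w * x)⁻¹ w := (hab _ hx _ hw).inv_left
  have h2 : Commute (x⁻¹ * w * x)⁻¹ (y⁻¹ * w * y)⁻¹ := ((hab _ hx _ hy).inv_left).inv_right
  have h3 : Commute w (y⁻¹ * w * y)⁻¹ := (hab _ hw _ hy).inv_right
  rw [← mul_assoc, ← mul_assoc, (h2.mul_left h3).eq, h1.eq, mul_assoc _ _ k, mul_assoc _ _ k]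
  simp only [mul_assoc]

open Subgroup in
/-- Every element of a group of class at most four generated by `x` and `y` is a product of powers
of `x`, `y` and six commutators. -/
theorem exists_eq_zpow_mul_prod {G : Type*} [Group G] {x y : G}
    (hgen : closure {x, y} = (⊤ : Subgroup G)) (hG : (⊤ : Subgroup G).lowerCentralSeries 4 = ⊥)
    (g : G) : ∃ a b n₀ n₁ n₂ n₃ n₄ n₅ : ℤ, g = x ^ a * y ^ b *
      (groupComm x y ^ n₀ * groupComm (groupComm x y) x ^ n₁ * groupComm (groupComm x y) y ^ n₂ *
        groupComm₄ x y x x ^ n₃ * groupComm₄ x y y x ^ n₄ * groupComm₄ x y y y ^ n₅) := by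
  have hab (p : G) (hp : p ∈ commutator G) (q : G) (hq : q ∈ commutator G) : Commute p q :=
    commute_of_mem_commutator hgen hG hp hq
  let A := commutator G
  have hA : IsMulCommutative A := ⟨⟨fun p q => Subtype.ext (hab p p.2 q q.2)⟩⟩
  have h1 : groupComm x y ∈ (⊤ : Subgroup G).lowerCentralSeries 1 :=
    groupComm_mem_lowerCentralSeries (n := 0) (mem_top x) y
  have h2 (g : G) := groupComm_mem_lowerCentralSeries h1 g
  have h3 (g h : G) := groupComm_mem_lowerCentralSeries (h2 g) h
  have h4 (g h k : G) : groupComm (groupComm₄ x y g h) k = 1 := by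
    rw [← mem_bot, ← hG]; exact groupComm_mem_lowerCentralSeries (h3 g h) k
  have hle {n : ℕ} (hn : 1 ≤ n) : (⊤ : Subgroup G).lowerCentralSeries n ≤ A :=
    Subgroup.lowerCentralSeries_antitone _ hn
  let t : Fin 6 → A := ![⟨groupComm x y, h1⟩,
    ⟨groupComm (groupComm x y) x, hle (by norm_num) (h2 x)⟩,
    ⟨groupComm (groupComm x y) y, hle (by norm_num) (h2 y)⟩,
    ⟨groupComm₄ x y x x, hle (by norm_num) (h3 x x)⟩,
    ⟨groupComm₄ x y y x, hle (by norm_num) (h3 y x)⟩,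
    ⟨groupComm₄ x y y y, hle (by norm_num) (h3 y y)⟩]
  let S : Subgroup G := (closure (Set.range t)).map A.subtype
  have hS : S = closure (Set.range fun i => (t i : G)) := by
    simp only [S, MonoidHom.map_closure, ← Set.range_comp]; rfl
  have ht (i : Fin 6) : (t i : G) ∈ S := hS ▸ subset_closure ⟨i, rfl⟩
  -- The subgroup `S` that the six commutators generate is stable under conjugation.
  have hstab (g : G) (hg : ∀ i, groupComm (t i : G) g ∈ S)
      (hg' : ∀ i, g * groupComm (t i : G) g * g⁻¹ ∈ S) : g ∈ normalizer (S : Set G) := by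
    have hmap : S.map (MulAut.conj g).toMonoidHom ≤ S := by
      rw [hS, MonoidHom.map_closure, closure_le, ← hS]
      rintro _ ⟨_, ⟨i, rfl⟩, rfl⟩
      have := mul_mem (ht i) (inv_mem (hg' i))
      simpa [groupComm, mul_assoc] using this
    have hmap' : S.map (MulAut.conj g⁻¹).toMonoidHom ≤ S := by
      rw [hS, MonoidHom.map_closure, closure_le, ← hS]
      rintro _ ⟨_, ⟨i, rfl⟩, rfl⟩
      have := mul_mem (ht i) (hg i)
      simpa [groupComm, mul_assoc] using this
    rw [mem_normalizer_iff]
    refine fun s => ⟨fun hs => hmap ⟨s, hs, rfl⟩, fun hs => ?_⟩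
    simpa [mul_assoc] using hmap' ⟨_, hs, rfl⟩
  -- As `g * s * g⁻¹ = s * (g * (s, g) * g⁻¹)⁻¹`, conjugates by `g` (rather than by `g⁻¹`) are
  -- handled by descending weight.
  have hconj (g : G) (s : G) (h : g * groupComm s g * g⁻¹ ∈ S) (hs : s ∈ S) : g * s * g⁻¹ ∈ S := by
    have := mul_mem hs (inv_mem h)
    simpa [groupComm, mul_assoc] using this
  have hcent (g h k : G) : k * groupComm (groupComm₄ x y g h) k * k⁻¹ ∈ S := by
    rw [h4]; simp
  have hswap : groupComm (groupComm (groupComm x y) x) y = groupComm₄ x y y x :=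
    groupComm_groupComm_comm hab h1 x y
  have hx : x ∈ normalizer (S : Set G) := by
    have c3 := hconj x _ (hcent x x x) (ht 3)
    have c4 := hconj x _ (hcent y x x) (ht 4)
    have c1 := hconj x _ c3 (ht 1)
    refine hstab x (fun i => ?_) fun i => ?_
    · fin_cases i
      · exact ht 1
      · exact ht 3
      · exact ht 4
      · exact (h4 x x x).symm ▸ one_mem S
      · exact (h4 y x x).symm ▸ one_mem S
      · exact (h4 y y x).symm ▸ one_mem S
    · fin_cases i
      · exact c1
      · exact c3
      · exact c4
      · exact hcent x x x
      · exact hcent y x x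
      · exact hcent y y x
  have hy : y ∈ normalizer (S : Set G) := by
    have c4 := hconj y _ (hcent y x y) (ht 4)
    have c5 := hconj y _ (hcent y y y) (ht 5)
    have c2 := hconj y _ c5 (ht 2)
    refine hstab y (fun i => ?_) fun i => ?_
    · fin_cases i
      · exact ht 2
      · exact hswap.symm ▸ ht 4
      · exact ht 5
      · exact (h4 x x y).symm ▸ one_mem S
      · exact (h4 y x y).symm ▸ one_mem S
      · exact (h4 y y y).symm ▸ one_mem S
    · fin_cases i
      · exact c2
      · exact hswap.symm ▸ c4
      · exact c5
      · exact hcent x x y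
      · exact hcent y x y
      · exact hcent y y y
  have hSn : S.Normal := by
    rw [← normalizer_eq_top_iff, eq_top_iff, ← hgen, closure_le]
    rintro _ (rfl | rfl)
    exacts [hx, hy]
  have hxy : ⁅x, y⁆ ∈ S := by
    -- The two commutator conventions differ by a conjugation.
    have : ⁅x, y⁆ = (y * x) * groupComm x y * (y * x)⁻¹ := by
      rw [groupComm, commutatorElement_def]; group
    rw [this]; exact hSn.conj_mem _ (ht 0) _
  have hAS : A ≤ S := commutator_le_of_closure_pair_eq_top hgen S hxy
  have hmem : Abelianization.of g ∈ closure {Abelianization.of x, Abelianization.of y} := by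
    rw [← Set.image_pair, ← MonoidHom.map_closure, hgen]
    exact ⟨g, mem_top g, rfl⟩
  obtain ⟨a, b, hg⟩ := mem_closure_pair.mp hmem
  have hz : (x ^ a * y ^ b)⁻¹ * g ∈ A := by
    rw [← map_zpow, ← map_zpow, ← map_mul] at hg
    exact QuotientGroup.eq.mp hg
  obtain ⟨s, hs, hsz⟩ := hAS hz
  obtain ⟨n, rfl⟩ := exists_of_mem_closure_range _ _ hs
  refine ⟨a, b, n 0, n 1, n 2, n 3, n 4, n 5, ?_⟩
  refine (inv_mul_eq_iff_eq_mul.mp hsz.symm).trans ?_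
  rw [Fin.prod_univ_six]
  rfl

/-! ### The model is the free nilpotent group -/

open PolyModel in
/-- The free nilpotent group of rank two and class four is isomorphic to the model: normal forms on
one side are sent to the corresponding triples on the other. -/
theorem exists_mulEquiv_polyModel : ∃ f : FreeNilpotentGroup 2 4 ≃* PolyModel,
    f (FreeNilpotentGroup.gen 0) = x ∧ f (FreeNilpotentGroup.gen 1) = y := by
  let γ := (⊤ : Subgroup (FreeGroup (Fin 2))).lowerCentralSeries 4
  let f₀ : FreeGroup (Fin 2) →* PolyModel := FreeGroup.lift ![x, y]
  have hker : ∀ g ∈ γ, f₀ g = 1 := by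
    intro g hg
    have h : f₀ g ∈ γ.map f₀ := ⟨g, hg, rfl⟩
    rw [Subgroup.map_lowerCentralSeries] at h
    have h' : f₀ g ∈ (⊤ : Subgroup PolyModel).lowerCentralSeries 4 :=
      Subgroup.lowerCentralSeries_mono 4 le_top h
    rwa [PolyModel.lowerCentralSeries_four, Subgroup.mem_bot] at h'
  let f : FreeNilpotentGroup 2 4 →* PolyModel := QuotientGroup.lift γ f₀ hker
  let gx : FreeNilpotentGroup 2 4 := FreeNilpotentGroup.gen 0
  let gy : FreeNilpotentGroup 2 4 := FreeNilpotentGroup.gen 1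
  have hx : f gx = x := (FreeGroup.lift_apply_of : f₀ (FreeGroup.of 0) = x)
  have hy : f gy = y := (FreeGroup.lift_apply_of : f₀ (FreeGroup.of 1) = y)
  have hsurj := QuotientGroup.mk'_surjective γ
  have hgen : Subgroup.closure {gx, gy} = ⊤ := by
    have h := congrArg (Subgroup.map (QuotientGroup.mk' γ)) (FreeGroup.closure_range_of (Fin 2))
    rw [MonoidHom.map_closure, Subgroup.map_top_of_surjective _ hsurj, ← Set.range_comp] at h
    rw [← h]
    congr 1
    ext g
    rw [Set.mem_range, Fin.exists_fin_two, eq_comm (b := g), eq_comm (b := g)]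
    rfl
  have hnil : (⊤ : Subgroup (FreeNilpotentGroup 2 4)).lowerCentralSeries 4 = ⊥ := by
    have h := Subgroup.map_lowerCentralSeries (⊤ : Subgroup (FreeGroup (Fin 2)))
      (QuotientGroup.mk' γ) 4
    rw [Subgroup.map_top_of_surjective _ hsurj] at h
    rw [← h]
    exact QuotientGroup.map_mk'_self γ
  have hf (a b n₀ n₁ n₂ n₃ n₄ n₅ : ℤ) : f (gx ^ a * gy ^ b *
      (groupComm gx gy ^ n₀ * groupComm (groupComm gx gy) gx ^ n₁ *
        groupComm (groupComm gx gy) gy ^ n₂ * groupComm₄ gx gy gx gx ^ n₃ *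
        groupComm₄ gx gy gy gx ^ n₄ * groupComm₄ gx gy gy gy ^ n₅)) =
      ⟨a, b, ⟨n₀, n₁, n₂, n₃, n₄, n₅⟩⟩ := by
    simp only [map_mul, map_zpow, groupComm₄, map_groupComm, hx, hy, groupComm_x_y,
      groupComm_mk_zero_zero_x, groupComm_mk_zero_zero_y, mk_zero_zero_zpow, mk_zero_zero_mul,
      mul_one]
    refine .trans ?_ (eq_zpow_mul_zpow_mul ⟨a, b, ⟨n₀, n₁, n₂, n₃, n₄, n₅⟩⟩).symm
    rw [TruncPoly.eq_sum_monomials ⟨n₀, n₁, n₂, n₃, n₄, n₅⟩]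
  refine ⟨MulEquiv.ofBijective f ⟨?_, fun g => ⟨_, hf g.a g.b g.r.c g.r.cx g.r.cy g.r.cxx g.r.cxy
    g.r.cyy⟩⟩, hx, hy⟩
  rw [injective_iff_map_eq_one]
  intro g hg
  obtain ⟨a, b, n₀, n₁, n₂, n₃, n₄, n₅, rfl⟩ := exists_eq_zpow_mul_prod hgen hnil g
  rw [hf, one_def, TruncPoly.zero_def] at hg
  simp only [mk.injEq, TruncPoly.mk.injEq] at hg
  obtain ⟨rfl, rfl, rfl, rfl, rfl, rfl, rfl, rfl⟩ := hg
  simp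

/-! ### Automorphisms of the model -/

namespace PolyModel

open TruncPoly

theorem apply_mk_zero_zero_eq_one {C : Type*} [CommGroup C] (χ : PolyModel →* C) (r : TruncPoly) :
    χ ⟨0, 0, r⟩ = 1 := by
  have h : (⟨0, 0, r⟩ : PolyModel) = groupComm x y ^ r.c *
      groupComm ⟨0, 0, ⟨r.cx, r.cxx, 0, 0, 0, 0⟩⟩ x *
      groupComm ⟨0, 0, ⟨r.cy, r.cxy, r.cyy, 0, 0, 0⟩⟩ y := by
    simp [-zsmul_eq_mul, groupComm_x_y, groupComm_mk_zero_zero_x, groupComm_mk_zero_zero_y,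
      mk_zero_zero_zpow, mk_zero_zero_mul, zsmul_def, X, Y, TruncPoly.one_def, TruncPoly.add_def, TruncPoly.mul_def]
  have hc (g h : C) : groupComm g h = 1 := by rw [groupComm]; simp [mul_comm]
  rw [h]
  simp [map_groupComm, hc]

variable (ψ : PolyModel ≃* PolyModel)

theorem apply_a (g : PolyModel) : (ψ g).a = g.a * (ψ x).a + g.b * (ψ y).a := by
  have h := congrArg (expX.comp ψ.toMonoidHom) (eq_zpow_mul_zpow_mul g)
  rw [map_mul, apply_mk_zero_zero_eq_one, map_mul, map_zpow, map_zpow, mul_one] at h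
  exact congrArg Multiplicative.toAdd h

theorem apply_b (g : PolyModel) : (ψ g).b = g.a * (ψ x).b + g.b * (ψ y).b := by
  have h := congrArg (expY.comp ψ.toMonoidHom) (eq_zpow_mul_zpow_mul g)
  rw [map_mul, apply_mk_zero_zero_eq_one, map_mul, map_zpow, map_zpow, mul_one] at h
  exact congrArg Multiplicative.toAdd h

/-- The determinant of the automorphism of `ℤ²` that an automorphism of the model induces modulo the
commutator subgroup. -/
def abDet : ℤ := (ψ x).a * (ψ y).b - (ψ x).b * (ψ y).a

theorem abDet_eq_one_or : abDet ψ = 1 ∨ abDet ψ = -1 := by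
  have h1 := apply_a ψ (ψ.symm x)
  have h2 := apply_b ψ (ψ.symm x)
  have h3 := apply_a ψ (ψ.symm y)
  have h4 := apply_b ψ (ψ.symm y)
  rw [ψ.apply_symm_apply] at h1 h2 h3 h4
  simp only [x, y] at h1 h2 h3 h4
  refine Int.eq_one_or_neg_one_of_mul_eq_one (u := abDet ψ) (v := abDet ψ.symm) ?_
  simp only [abDet, x, y]
  grind

/-- The automorphism of the commutator subgroup that an automorphism of the model induces. -/
def commutatorMap : TruncPoly →+ TruncPoly where
  toFun r := (ψ ⟨0, 0, r⟩).r
  map_zero' := by rw [← one_def, map_one]; rfl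
  map_add' r s := by
    have h := apply_a ψ ⟨0, 0, s⟩
    have h' := apply_b ψ ⟨0, 0, s⟩
    simp only [zero_mul, add_zero] at h h'
    rw [← mk_zero_zero_mul, map_mul, mul_def, h, h']
    simp

theorem apply_mk_zero_zero (r : TruncPoly) : ψ ⟨0, 0, r⟩ = ⟨0, 0, commutatorMap ψ r⟩ := by
  refine PolyModel.ext ?_ ?_ rfl
  · simpa using apply_a ψ ⟨0, 0, r⟩
  · simpa using apply_b ψ ⟨0, 0, r⟩

theorem commutatorMap_X_mul (r : TruncPoly) : commutatorMap ψ (X * r) =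
    (powX (ψ x).a * powY (ψ x).b - 1) * commutatorMap ψ r := by
  have h := map_groupComm ψ.toMonoidHom ⟨0, 0, r⟩ x
  rw [groupComm_mk_zero_zero_x] at h
  change ψ _ = groupComm (ψ _) (ψ x) at h
  rw [apply_mk_zero_zero, apply_mk_zero_zero, groupComm_mk_zero_zero] at h
  exact congrArg PolyModel.r h

theorem commutatorMap_Y_mul (r : TruncPoly) : commutatorMap ψ (Y * r) =
    (powX (ψ y).a * powY (ψ y).b - 1) * commutatorMap ψ r := by
  have h := map_groupComm ψ.toMonoidHom ⟨0, 0, r⟩ y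
  rw [groupComm_mk_zero_zero_y] at h
  change ψ _ = groupComm (ψ _) (ψ y) at h
  rw [apply_mk_zero_zero, apply_mk_zero_zero, groupComm_mk_zero_zero] at h
  exact congrArg PolyModel.r h

theorem commutatorMap_one_c : (commutatorMap ψ 1).c = abDet ψ := by
  have h := map_groupComm ψ.toMonoidHom x y
  rw [groupComm_x_y] at h
  change ψ _ = groupComm (ψ x) (ψ y) at h
  rw [apply_mk_zero_zero, groupComm_mk] at h
  have h' := congrArg PolyModel.r h
  dsimp only at h'
  rw [h']
  simp [TruncPoly.mul_def, TruncPoly.add_def, TruncPoly.sub_def, TruncPoly.one_def, powX, powY,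
    quotX, quotY, abDet]
  ring

theorem commutatorMap_eq (r : TruncPoly) : commutatorMap ψ r =
    r.c • commutatorMap ψ 1 + r.cx • commutatorMap ψ X + r.cy • commutatorMap ψ Y +
      r.cxx • commutatorMap ψ (X * X) + r.cxy • commutatorMap ψ (X * Y) +
      r.cyy • commutatorMap ψ (Y * Y) := by
  conv_lhs => rw [eq_sum_monomials r]
  simp only [map_add, map_zsmul]

/-- As `ψ` maps commutators with `x` and `y` to commutators with `ψ x` and `ψ y`, the action of
`commutatorMap ψ` on monomials is the multiplicative substitution `X ↦ u`, `Y ↦ v`, up to the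
factor `commutatorMap ψ 1`. -/
theorem commutatorMap_monomials :
    let p := commutatorMap ψ 1
    let u := powX (ψ x).a * powY (ψ x).b - 1
    let v := powX (ψ y).a * powY (ψ y).b - 1
    commutatorMap ψ X = u * p ∧ commutatorMap ψ Y = v * p ∧
      commutatorMap ψ (X * X) = u * (u * p) ∧ commutatorMap ψ (X * Y) = u * (v * p) ∧
      commutatorMap ψ (Y * Y) = v * (v * p) := by
  have hX := commutatorMap_X_mul ψ 1
  have hY := commutatorMap_Y_mul ψ 1
  rw [mul_one] at hX hY
  simp only [commutatorMap_X_mul, commutatorMap_Y_mul, hX, hY, and_self]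

theorem commutatorMap_c (r : TruncPoly) : (commutatorMap ψ r).c = abDet ψ * r.c := by
  obtain ⟨h1, h2, h3, h4, h5⟩ := commutatorMap_monomials ψ
  rw [commutatorMap_eq, h1, h2, h3, h4, h5, ← commutatorMap_one_c]
  generalize commutatorMap ψ 1 = p
  simp [-zsmul_eq_mul, TruncPoly.mul_def, TruncPoly.add_def, TruncPoly.sub_def, TruncPoly.one_def,
    powX, powY, zsmul_def]
  ring

theorem commutatorMap_linear {r : TruncPoly} (h : r.c = 0) :
    (commutatorMap ψ r).cx = abDet ψ * ((ψ x).a * r.cx + (ψ y).a * r.cy) ∧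
      (commutatorMap ψ r).cy = abDet ψ * ((ψ x).b * r.cx + (ψ y).b * r.cy) := by
  obtain ⟨h1, h2, h3, h4, h5⟩ := commutatorMap_monomials ψ
  rw [commutatorMap_eq, h1, h2, h3, h4, h5, ← commutatorMap_one_c]
  generalize commutatorMap ψ 1 = p
  simp [-zsmul_eq_mul, TruncPoly.mul_def, TruncPoly.add_def, TruncPoly.sub_def, TruncPoly.one_def,
    powX, powY, zsmul_def, h]
  constructor <;> ring

/-- The matrix of the action of an automorphism of the model on the centre, in the basis
`X², XY, Y²`: the symmetric square of its matrix modulo commutators, multiplied by the determinant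
of the latter. -/
def centerMatrix : Matrix (Fin 3) (Fin 3) ℤ :=
  abDet ψ • !![(ψ x).a ^ 2, (ψ x).a * (ψ y).a, (ψ y).a ^ 2;
    2 * ((ψ x).a * (ψ x).b), (ψ x).a * (ψ y).b + (ψ x).b * (ψ y).a, 2 * ((ψ y).a * (ψ y).b);
    (ψ x).b ^ 2, (ψ x).b * (ψ y).b, (ψ y).b ^ 2]

open Matrix in
theorem commutatorMap_quadratic {r : TruncPoly} (h : r.c = 0) (hx : r.cx = 0) (hy : r.cy = 0) :
    ![(commutatorMap ψ r).cxx, (commutatorMap ψ r).cxy, (commutatorMap ψ r).cyy] =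
      centerMatrix ψ *ᵥ ![r.cxx, r.cxy, r.cyy] := by
  obtain ⟨h1, h2, h3, h4, h5⟩ := commutatorMap_monomials ψ
  rw [commutatorMap_eq, h1, h2, h3, h4, h5, centerMatrix, ← commutatorMap_one_c]
  generalize commutatorMap ψ 1 = p
  ext i
  fin_cases i <;> simp [-zsmul_eq_mul, Matrix.mulVec, dotProduct, Fin.sum_univ_three,
    TruncPoly.mul_def, TruncPoly.add_def, TruncPoly.sub_def, TruncPoly.one_def, powX, powY,
    zsmul_def, h, hx, hy] <;> ring

/-- If `λ` and `μ` are the eigenvalues modulo commutators, those on the centre are `λμ` times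
`λ²`, `λμ` and `μ²`, and `(λμ)²` is `1`. -/
theorem det_centerMatrix_sub_one : (centerMatrix ψ - 1).det = 0 := by
  rcases abDet_eq_one_or ψ with h | h <;>
  · rw [centerMatrix, h]
    rw [abDet] at h
    simp [Matrix.det_fin_three]
    grind

end PolyModel

/-! ### Twisted conjugacy classes -/

theorem reidemeisterNumber_eq_top {G : Type*} [Group G] (φ : G ≃* G) (s : ℤ → G)
    (hs : ∀ m n z, φ z * s m = s n * z → m = n) : reidemeisterNumber φ = ⊤ := by
  have : Infinite (Quotient (twistedConjSetoid φ)) :=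
    Infinite.of_injective (fun n => Quotient.mk (twistedConjSetoid φ) (s n)) fun m n h => by
      obtain ⟨z, hz⟩ := Quotient.exact h
      exact hs m n z hz
  exact ENat.card_eq_top.mpr this

namespace PolyModel

open TruncPoly Matrix

variable (ψ : PolyModel ≃* PolyModel)

/-- An eigenvalue `1` modulo commutators yields a `ψ`-invariant homomorphism to `ℤ`, which is
constant on twisted conjugacy classes. -/
theorem exists_separated_of_det_eq_zero
    (h : !![(ψ x).a - 1, (ψ x).b; (ψ y).a, (ψ y).b - 1].det = 0) :
    ∃ s : ℤ → PolyModel, ∀ m n z, ψ z * s m = s n * z → m = n := by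
  obtain ⟨v, hv, hA⟩ := exists_mulVec_eq_zero_iff.mpr h
  have h0 := congrFun hA 0
  have h1 := congrFun hA 1
  simp [mulVec, dotProduct, Fin.sum_univ_two] at h0 h1
  refine ⟨fun n => ⟨n * v 0, n * v 1, 0⟩, fun m n z hz => ?_⟩
  have ha := congrArg PolyModel.a hz
  have hb := congrArg PolyModel.b hz
  simp only [mul_def, apply_a ψ z, apply_b ψ z] at ha hb
  have hv2 : v 0 * v 0 + v 1 * v 1 ≠ 0 := by
    refine fun h => hv ?_
    obtain ⟨h0, h1⟩ := mul_self_add_mul_self_eq_zero.mp h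
    ext i; fin_cases i
    exacts [h0, h1]
  have : (m - n) * (v 0 * v 0 + v 1 * v 1) = 0 := by
    linear_combination v 0 * ha + v 1 * hb - z.a * h0 - z.b * h1
  have := (mul_eq_zero.mp this).resolve_right hv2
  linarith

theorem a_eq_zero_and_b_eq_zero
    (h : !![(ψ x).a - 1, (ψ x).b; (ψ y).a, (ψ y).b - 1].det ≠ 0) {z : PolyModel} {r s : TruncPoly}
    (hz : ψ z * ⟨0, 0, r⟩ = ⟨0, 0, s⟩ * z) : z.a = 0 ∧ z.b = 0 := by
  have ha := congrArg PolyModel.a hz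
  have hb := congrArg PolyModel.b hz
  simp only [mul_def, apply_a ψ z, apply_b ψ z] at ha hb
  have h0 : ![z.a, z.b] = 0 := by
    refine eq_zero_of_vecMul_eq_zero h ?_
    ext i; fin_cases i <;> simp [vecMul, dotProduct, Fin.sum_univ_two]
    · linear_combination ha
    · linear_combination hb
  exact ⟨congrFun h0 0, congrFun h0 1⟩

/-- Without eigenvalue `1` modulo commutators, elements of the commutator subgroup are twisted
conjugate only by elements of that subgroup. -/
theorem commutatorMap_add_eq
    (h : !![(ψ x).a - 1, (ψ x).b; (ψ y).a, (ψ y).b - 1].det ≠ 0) {z : PolyModel} {r s : TruncPoly}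
    (hz : ψ z * ⟨0, 0, r⟩ = ⟨0, 0, s⟩ * z) : commutatorMap ψ z.r + r = s + z.r := by
  obtain ⟨ha, hb⟩ := a_eq_zero_and_b_eq_zero ψ h hz
  obtain ⟨a, b, t⟩ := z
  obtain rfl : a = 0 := ha
  obtain rfl : b = 0 := hb
  rw [apply_mk_zero_zero, mk_zero_zero_mul, mk_zero_zero_mul] at hz
  exact congrArg PolyModel.r hz

theorem exists_separated :
    ∃ s : ℤ → PolyModel, ∀ m n z, ψ z * s m = s n * z → m = n := by
  by_cases h : !![(ψ x).a - 1, (ψ x).b; (ψ y).a, (ψ y).b - 1].det = 0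
  · exact exists_separated_of_det_eq_zero ψ h
  rcases abDet_eq_one_or ψ with hd | hd
  · -- The powers of `(x, y)` are separated, since `ψ` fixes `(x, y)` modulo higher commutators.
    refine ⟨fun n => ⟨0, 0, ⟨n, 0, 0, 0, 0, 0⟩⟩, fun m n z hz => ?_⟩
    have hc := congrArg TruncPoly.c (commutatorMap_add_eq ψ h hz)
    simp only [TruncPoly.add_def, commutatorMap_c, hd] at hc
    linarith
  · -- If the determinant is `-1` and `1` is not an eigenvalue, then `-1` is not one either, and a
    -- central element is twisted conjugate to another one only by central elements.
    obtain ⟨v, hv, hM⟩ := exists_vecMul_eq_zero_iff.mpr (det_centerMatrix_sub_one ψ)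
    refine ⟨fun n => ⟨0, 0, ⟨0, 0, 0, n * v 0, n * v 1, n * v 2⟩⟩, fun m n z hz => ?_⟩
    have hr := commutatorMap_add_eq ψ h hz
    simp only [TruncPoly.add_def, TruncPoly.ext_iff] at hr
    obtain ⟨e0, e1, e2, e3, e4, e5⟩ := hr
    have hc : z.r.c = 0 := by
      rw [commutatorMap_c, hd] at e0
      linarith
    obtain ⟨l1, l2⟩ := commutatorMap_linear ψ hc
    rw [hd] at l1 l2
    rw [det_fin_two] at h
    simp at h
    rw [abDet] at hd
    have h12 : z.r.cx = 0 ∧ z.r.cy = 0 := by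
      have ht : (ψ x).a + (ψ y).b ≠ 0 := fun ht => h (by linear_combination hd - ht)
      constructor
      · refine (mul_eq_zero.mp ?_).resolve_left ht
        have f1 : ((ψ x).a + 1) * z.r.cx + (ψ y).a * z.r.cy = 0 := by linear_combination l1 - e1
        have f2 : (ψ x).b * z.r.cx + ((ψ y).b + 1) * z.r.cy = 0 := by linear_combination l2 - e2
        linear_combination ((ψ y).b + 1) * f1 - (ψ y).a * f2 - z.r.cx * hd
      · refine (mul_eq_zero.mp ?_).resolve_left ht
        have f1 : ((ψ x).a + 1) * z.r.cx + (ψ y).a * z.r.cy = 0 := by linear_combination l1 - e1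
        have f2 : (ψ x).b * z.r.cx + ((ψ y).b + 1) * z.r.cy = 0 := by linear_combination l2 - e2
        linear_combination ((ψ x).a + 1) * f2 - (ψ x).b * f1 - z.r.cy * hd
    have hq := commutatorMap_quadratic ψ hc h12.1 h12.2
    set u := ![z.r.cxx, z.r.cxy, z.r.cyy] with hu
    have hinv : v ⬝ᵥ (centerMatrix ψ *ᵥ u) = v ⬝ᵥ u := by
      rw [vecMul_sub, vecMul_one, sub_eq_zero] at hM
      rw [dotProduct_mulVec, hM]
    rw [← hq] at hinv
    simp [dotProduct, Fin.sum_univ_three, hu] at hinv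
    have hv2 : v ⬝ᵥ v ≠ 0 := fun h => hv (dotProduct_self_eq_zero.mp h)
    have : (m - n) * (v ⬝ᵥ v) = 0 := by
      simp only [dotProduct, Fin.sum_univ_three]
      linear_combination v 0 * e3 + v 1 * e4 + v 2 * e5 - hinv
    have := (mul_eq_zero.mp this).resolve_right hv2
    linarith

end PolyModel

/-! ### The centre -/

namespace PolyModel

/-- The coordinates of a central element are the coefficients at `X²`, `XY`, `Y²`. -/
def centerEquiv : Additive (Subgroup.center PolyModel) ≃ₗ[ℤ] (Fin 3 → ℤ) :=
  AddEquiv.toIntLinearEquiv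
    { toFun := fun z => ![(z.toMul : PolyModel).r.cxx, (z.toMul : PolyModel).r.cxy,
        (z.toMul : PolyModel).r.cyy]
      invFun := fun v => .ofMul ⟨⟨0, 0, ⟨0, 0, 0, v 0, v 1, v 2⟩⟩, mem_center_iff.mpr (by simp)⟩
      left_inv := by
        intro z
        obtain ⟨h1, h2, h3, h4, h5⟩ := mem_center_iff.mp z.toMul.2
        refine congrArg Additive.ofMul (Subtype.ext (PolyModel.ext h1.symm h2.symm ?_))
        exact TruncPoly.ext h3.symm h4.symm h5.symm rfl rfl rfl
      right_inv := fun v => by ext i; fin_cases i <;> rfl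
      map_add' := fun z w => by
        obtain ⟨h1, h2, h3, h4, h5⟩ := mem_center_iff.mp z.toMul.2
        obtain ⟨k1, k2, k3, k4, k5⟩ := mem_center_iff.mp w.toMul.2
        simp [mul_def, h1, h2, k1, k2, TruncPoly.add_def] }

theorem coe_centerEquiv_symm (v : Fin 3 → ℤ) :
    ((centerEquiv.symm v).toMul : PolyModel) = ⟨0, 0, ⟨0, 0, 0, v 0, v 1, v 2⟩⟩ := rfl

theorem centerEquiv_apply (z : Additive (Subgroup.center PolyModel)) :
    centerEquiv z = ![(z.toMul : PolyModel).r.cxx, (z.toMul : PolyModel).r.cxy,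
      (z.toMul : PolyModel).r.cyy] := rfl

end PolyModel

open PolyModel in
theorem theorem1 {N : Type*} [Group N] (e : FreeNilpotentGroup 2 4 ≃* N) (x y : N)
    (hx : x = e (FreeNilpotentGroup.gen 0)) (hy : y = e (FreeNilpotentGroup.gen 1)) :
    ∃ b : Module.Basis (Fin 3) ℤ (Additive (Subgroup.center N)),
      (((b 0).toMul : N) = groupComm₄ x y x x ∧
        ((b 1).toMul : N) = groupComm₄ x y y x ∧
        ((b 2).toMul : N) = groupComm₄ x y y y) ∧
      (∀ φ : N ≃* N,
        (LinearMap.toMatrix b b (centerAut φ).toLinearMap - 1).det = 0) ∧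
      HasRInfinity N := by
  obtain ⟨f, hfx, hfy⟩ := exists_mulEquiv_polyModel
  let E : N ≃* PolyModel := e.symm.trans f
  have hEx : E x = PolyModel.x := by simp [E, hx, hfx]
  have hEy : E y = PolyModel.y := by simp [E, hy, hfy]
  let E' : Additive (Subgroup.center N) ≃ₗ[ℤ] Additive (Subgroup.center PolyModel) :=
    (MulEquiv.toAdditive (Subgroup.centerCongr E)).toIntLinearEquiv
  let b : Module.Basis (Fin 3) ℤ (Additive (Subgroup.center N)) :=
    .ofEquivFun (E'.trans centerEquiv)
  have hb (i : Fin 3) : E ((b i).toMul : N) =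
      ⟨0, 0, ⟨0, 0, 0, (Pi.single i 1 : Fin 3 → ℤ) 0, (Pi.single i 1 : Fin 3 → ℤ) 1,
        (Pi.single i 1 : Fin 3 → ℤ) 2⟩⟩ := by
    have h : E' (b i) = centerEquiv.symm (Pi.single i 1) := by
      simp [b]
    rw [← coe_centerEquiv_symm, ← h]
    rfl
  have hcomm (k l : N) : E (groupComm₄ x y k l) =
      groupComm (groupComm ⟨0, 0, 1⟩ (E k)) (E l) := by
    rw [← groupComm_x_y, ← hEx, ← hEy]
    simp [groupComm₄, groupComm]
  refine ⟨b, ⟨?_, ?_, ?_⟩, fun φ => ?_, fun φ => ?_⟩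
  · apply E.injective
    rw [hb]
    simp [hcomm, hEx, groupComm_mk_zero_zero_x, TruncPoly.X, TruncPoly.one_def,
      TruncPoly.mul_def]
  · apply E.injective
    rw [hb]
    simp [hcomm, hEx, hEy, groupComm_mk_zero_zero_x, groupComm_mk_zero_zero_y,
      TruncPoly.X, TruncPoly.Y, TruncPoly.one_def, TruncPoly.mul_def]
  · apply E.injective
    rw [hb]
    simp [hcomm, hEy, groupComm_mk_zero_zero_y, TruncPoly.Y, TruncPoly.one_def,
      TruncPoly.mul_def]
  · let ψ : PolyModel ≃* PolyModel := (E.symm.trans φ).trans E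
    have hM : LinearMap.toMatrix b b (centerAut φ).toLinearMap = centerMatrix ψ := by
      ext i j
      rw [LinearMap.toMatrix_apply]
      have h : ((E' (centerAut φ (b j))).toMul : PolyModel) = ψ (E ((b j).toMul : N)) := by
        change E (φ ((b j).toMul : N)) = _
        simp [ψ]
      change centerEquiv (E' (centerAut φ (b j))) i = _
      rw [centerEquiv_apply, h, hb, apply_mk_zero_zero]
      dsimp only
      rw [commutatorMap_quadratic ψ rfl rfl rfl]
      have hv (v : Fin 3 → ℤ) : ![v 0, v 1, v 2] = v := by ext k; fin_cases k <;> rfl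
      simp [hv]
    rw [hM, det_centerMatrix_sub_one]
  · obtain ⟨s, hs⟩ := exists_separated ((E.symm.trans φ).trans E)
    refine reidemeisterNumber_eq_top φ (fun n => E.symm (s n)) fun m n z hz => hs m n (E z) ?_
    simpa using congrArg E hz
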